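/- Let $n\ge 3$. Let $X=\begin{pmatrix}0&1\\1&0\end{pmatrix}$, $Y=\begin{pmatrix}0&-i\\i&0\end{pmatrix}$, $Z=\begin{pmatrix}1&0\\0&-1\end{pmatrix}$, let $\hat{\mathcal P}_n=\{\sigma_1\otimes\cdots\otimes\sigma_n : \sigma_k\in\{I_2,X,Y,Z\}\}$, and let $\langle\hat{\mathcal P}_n\rangle$ be the subgroup it generates in the group $\mathcal U(2^n)$ of $2^n\times 2^n$ complex unitary matrices. Let $\mathcal C_n$ be the $n$-qubit Clifford group modulo global phase, that is, the quotient of the normalizer of $\langle\hat{\mathcal P}_n\rangle$ in $\mathcal U(2^n)$ by its subgroup of all unitary scalar matrices. Then the trivial character is the only linear character of $\mathcal C_n$, i.e. every group homomorphism $\mathcal C_n\to\mathbb C^\times$ is trivial, and $\mathcal C_n$ is perfect, i.e. $\mathcal C_n=[\mathcal C_n,\mathcal C_n]$. -/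

import Mathlib

/-- The Pauli matrix `X`, as a unitary matrix. -/
noncomputable def pauliX : Matrix.unitaryGroup (Fin 2) ℂ :=
  ⟨!![0, 1; 1, 0], by
    rw [Matrix.mem_unitaryGroup_iff]
    ext i j
    fin_cases i <;> fin_cases j <;> simp [Matrix.mul_apply, Matrix.star_apply]⟩

/-- The Pauli matrix `Y`, as a unitary matrix. -/
noncomputable def pauliY : Matrix.unitaryGroup (Fin 2) ℂ :=
  ⟨!![0, -Complex.I; Complex.I, 0], by
    rw [Matrix.mem_unitaryGroup_iff]
    ext i j
    fin_cases i <;> fin_cases j <;> simp [Matrix.mul_apply, Matrix.star_apply]⟩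

/-- The Pauli matrix `Z`, as a unitary matrix. -/
noncomputable def pauliZ : Matrix.unitaryGroup (Fin 2) ℂ :=
  ⟨!![1, 0; 0, -1], by
    rw [Matrix.mem_unitaryGroup_iff]
    ext i j
    fin_cases i <;> fin_cases j <;> simp [Matrix.mul_apply, Matrix.star_apply]⟩

/-- The Kronecker product `A₁ ⊗ ⋯ ⊗ Aₙ` of `2 × 2` matrices, a `2ⁿ × 2ⁿ` matrix whose rows and
columns are indexed by the computational basis `{0,1}ⁿ` of `(ℂ²)^{⊗ n}`. -/
def tensorMatrix {n : ℕ} (A : Fin n → Matrix (Fin 2) (Fin 2) ℂ) :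
    Matrix (Fin n → Fin 2) (Fin n → Fin 2) ℂ :=
  Matrix.of fun x y => ∏ k, A k (x k) (y k)

theorem tensorMatrix_mul {n : ℕ} (A B : Fin n → Matrix (Fin 2) (Fin 2) ℂ) :
    tensorMatrix A * tensorMatrix B = tensorMatrix (fun k => A k * B k) := by
  ext x y
  simp only [tensorMatrix, Matrix.mul_apply, Matrix.of_apply, ← Finset.prod_mul_distrib]
  exact (Fintype.prod_sum (fun k j => A k (x k) j * B k j (y k))).symm

theorem tensorMatrix_one {n : ℕ} :
    tensorMatrix (fun _ : Fin n => (1 : Matrix (Fin 2) (Fin 2) ℂ)) = 1 := by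
  ext x y
  simp only [tensorMatrix, Matrix.of_apply, Matrix.one_apply]
  by_cases h : x = y
  · simp [h]
  · obtain ⟨k, hk⟩ := Function.ne_iff.mp h
    rw [if_neg h]
    exact Finset.prod_eq_zero (Finset.mem_univ k) (if_neg hk)

theorem star_tensorMatrix {n : ℕ} (A : Fin n → Matrix (Fin 2) (Fin 2) ℂ) :
    star (tensorMatrix A) = tensorMatrix (fun k => star (A k)) := by
  ext x y
  simp [tensorMatrix, Matrix.star_apply]

/-- The Kronecker product `U₁ ⊗ ⋯ ⊗ Uₙ` of `2 × 2` unitary matrices, in the group of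
`2ⁿ × 2ⁿ` unitary matrices. -/
def tensorUnitary {n : ℕ} (U : Fin n → Matrix.unitaryGroup (Fin 2) ℂ) :
    Matrix.unitaryGroup (Fin n → Fin 2) ℂ :=
  ⟨tensorMatrix (fun k => (U k : Matrix (Fin 2) (Fin 2) ℂ)), by
    rw [Matrix.mem_unitaryGroup_iff, star_tensorMatrix, tensorMatrix_mul]
    have h : ∀ k, (U k : Matrix (Fin 2) (Fin 2) ℂ) * star (U k : Matrix (Fin 2) (Fin 2) ℂ) = 1 :=
      fun k => Matrix.mem_unitaryGroup_iff.mp (U k).2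
    simp only [h]
    exact tensorMatrix_one⟩

/-- The set of `n`-qubit Pauli matrices `σ₁ ⊗ ⋯ ⊗ σₙ` with `σₖ ∈ {I, X, Y, Z}`. -/
def pauliMatrices (n : ℕ) : Set (Matrix.unitaryGroup (Fin n → Fin 2) ℂ) :=
  {S | ∃ σ : Fin n → Matrix.unitaryGroup (Fin 2) ℂ,
    (∀ k, σ k = 1 ∨ σ k = pauliX ∨ σ k = pauliY ∨ σ k = pauliZ) ∧ S = tensorUnitary σ}

/-- The subgroup of the unitary group generated by the `n`-qubit Pauli matrices. -/
def pauliSubgroup (n : ℕ) : Subgroup (Matrix.unitaryGroup (Fin n → Fin 2) ℂ) :=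
  Subgroup.closure (pauliMatrices n)

/-- The unitary matrices `A` with `A ⟨Pauli⟩ A⁻¹ = ⟨Pauli⟩`, before dividing out the phase.
(As `⟨Pauli⟩` is finite, this is the same as `A ⟨Pauli⟩ A⁻¹ ⊆ ⟨Pauli⟩`.) -/
def cliffordUnitaries (n : ℕ) : Subgroup (Matrix.unitaryGroup (Fin n → Fin 2) ℂ) :=
  Subgroup.normalizer (pauliSubgroup n : Set (Matrix.unitaryGroup (Fin n → Fin 2) ℂ))

/-- The global phases: all unitary scalar matrices. -/
def globalPhase (n : ℕ) : Subgroup (Matrix.unitaryGroup (Fin n → Fin 2) ℂ) where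
  carrier := {U | ∃ c : ℂ, (U : Matrix (Fin n → Fin 2) (Fin n → Fin 2) ℂ) = c • 1}
  one_mem' := ⟨1, by simp⟩
  mul_mem' := by
    rintro U V ⟨c, hc⟩ ⟨d, hd⟩
    exact ⟨c * d, by simp [hc, hd, smul_smul, mul_comm]⟩
  inv_mem' := by
    rintro U ⟨c, hc⟩
    exact ⟨star c, by simp [hc]⟩

instance globalPhase_normal (n : ℕ) : (globalPhase n).Normal where
  conj_mem := by
    rintro U ⟨c, hc⟩ V
    refine ⟨c, ?_⟩
    have h : (V : Matrix (Fin n → Fin 2) (Fin n → Fin 2) ℂ) *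
        star (V : Matrix (Fin n → Fin 2) (Fin n → Fin 2) ℂ) = 1 :=
      Matrix.mem_unitaryGroup_iff.mp V.2
    simp [hc, h]

/-- The `n`-qubit Clifford group: the normalizer of the Pauli group in the unitary group, in which
two matrices are identified if they differ by a scalar matrix. -/
abbrev CliffordGroup (n : ℕ) : Type :=
  cliffordUnitaries n ⧸ (globalPhase n).subgroupOf (cliffordUnitaries n)

/-! Let `f` be a homomorphism from the group of Clifford unitaries to a commutative group that is
trivial on scalars; it has to be shown that `f` is trivial. Applied to a linear character of the
Clifford group, and to the projection onto its abelianization, this gives both claims.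

For a nonscalar involution `R` of the Pauli group, let `S_R = (1 + R) / 2 + i (1 - R) / 2` be its
phase gate. If `P` and `Q` are anticommuting involutions, then `S_R P S_R⁻¹ = Q` for `R = -i P Q`.
This has two consequences.

* The phase gates and the scalars generate the Clifford unitaries (`cliffordUnitaries_le`). Given a
  Clifford unitary `U`, one multiplies it by phase gates to make it commute with
  `X₁, Z₁, X₂, Z₂, …` one after the other, where at each stage the gates used commute with the
  generators already dealt with. A unitary commuting with all of them is scalar
  (`mem_globalPhase_of_commute`).
* All phase gates are conjugate, since any two nonscalar Pauli involutions have a common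
  anticommuting partner. So `f` takes one value `t` on all of them (`map_cliffordPhaseGate_eq`).

Now `S_R S_{-R} = i` gives `t ^ 2 = 1`. If there are three qubits, consider the seven nontrivial
products of `Z₁`, `Z₂`, `Z₃`. On any computational basis vector either none or exactly four of them
take the value `-1`, so their phase gates multiply to `1`, as `i ^ 4 = 1`. Hence `t ^ 7 = 1`, and
`t = 1`. -/

/-! ### The element with eigenvalues `1` and `i` attached to an involution -/

/-- The element `(1 + r) / 2 + i (1 - r) / 2`. For an involution `r` it acts as `1` on the
`1`-eigenspace of `r` and as `i` on the `-1`-eigenspace; for `r = Z` it is the usual phase gate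
`diag(1, i)`. -/
noncomputable def phaseElement {A : Type*} [Ring A] [Algebra ℂ A] (r : A) : A :=
  ((1 + Complex.I) / 2) • (1 : A) + ((1 - Complex.I) / 2) • r

section Algebra
variable {A : Type*} [Ring A] [Algebra ℂ A] {p q r : A}

theorem phaseElement_mul_self (hr : r * r = 1) : phaseElement r * phaseElement r = r := by
  simp only [phaseElement, add_mul, mul_add, smul_mul_assoc, mul_smul_comm, one_mul, mul_one, hr]
  match_scalars <;> ring_nf
  all_goals
    simp only [Complex.I_sq]
    ring

theorem phaseElement_mul_neg (hr : r * r = 1) :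
    phaseElement r * phaseElement (-r) = Complex.I • (1 : A) := by
  simp only [phaseElement, add_mul, mul_add, smul_mul_assoc, mul_smul_comm, one_mul, mul_one,
    mul_neg, hr]
  match_scalars <;> ring_nf

theorem phaseElement_mul_of_anticommute (hr : r * r = 1) (h : r * p = -(p * r)) :
    phaseElement r * p = (-Complex.I) • (r * p) * phaseElement r := by
  have h' : r * p * r = -p := by rw [h, neg_mul, mul_assoc, hr, mul_one]
  simp only [phaseElement, add_mul, mul_add, smul_mul_assoc, mul_smul_comm, one_mul, mul_one, h']
  match_scalars <;> ring_nf
  all_goals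
    simp only [Complex.I_sq]
    ring

/-- If `p` and `q` are anticommuting involutions, conjugation by the phase element of `-i p q`
carries `p` to `q`, with the correct sign. -/
theorem phaseElement_mul_eq (hp : p * p = 1) (hq : q * q = 1) (h : p * q = -(q * p)) :
    phaseElement ((-Complex.I) • (p * q)) * p =
      q * phaseElement ((-Complex.I) • (p * q)) := by
  have h1 : p * q * p = -q := by rw [h, neg_mul, mul_assoc, hp, mul_one]
  have h2 : q * (p * q) = -p := by rw [h, mul_neg, ← mul_assoc, hq, one_mul]
  simp only [phaseElement, add_mul, mul_add, smul_mul_assoc, mul_smul_comm, one_mul, mul_one,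
    h1, h2]
  match_scalars <;> ring_nf
  all_goals
    simp only [Complex.I_sq]
    ring

theorem phaseElement_mul_star [StarRing A] [StarModule ℂ A] (hr : r * r = 1) (hs : star r = r) :
    phaseElement r * star (phaseElement r) = 1 := by
  simp only [phaseElement, star_add, star_smul, star_one, hs, add_mul, mul_add, smul_mul_assoc,
    mul_smul_comm, one_mul, mul_one, hr]
  match_scalars <;> simp <;> ring_nf
  all_goals
    simp only [Complex.I_sq]
    ring
theorem SemiconjBy.phaseElement {v : A} (h : SemiconjBy v p q) :
    SemiconjBy v (phaseElement p) (phaseElement q) :=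
  ((SemiconjBy.one_right v).smul_right _).add_right (h.smul_right _)

end Algebra

/-! ### One-qubit operators and the commutant of the Pauli matrices -/

section
variable {n : ℕ}

/-- `tensorUnitary` as a group homomorphism. -/
def tensorHom (n : ℕ) :
    (Fin n → Matrix.unitaryGroup (Fin 2) ℂ) →* Matrix.unitaryGroup (Fin n → Fin 2) ℂ where
  toFun := tensorUnitary
  map_one' := Subtype.ext tensorMatrix_one
  map_mul' _ _ := Subtype.ext (tensorMatrix_mul _ _).symm

/-- `I ⊗ ⋯ ⊗ U ⊗ ⋯ ⊗ I` with `U` in position `k`, as a homomorphism in `U`. -/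
def onQubit (k : Fin n) :
    Matrix.unitaryGroup (Fin 2) ℂ →* Matrix.unitaryGroup (Fin n → Fin 2) ℂ :=
  (tensorHom n).comp (MonoidHom.mulSingle (fun _ : Fin n => Matrix.unitaryGroup (Fin 2) ℂ) k)

theorem onQubit_commute {j k : Fin n} (h : j ≠ k) (U V : Matrix.unitaryGroup (Fin 2) ℂ) :
    Commute (onQubit j U) (onQubit k V) :=
  (Pi.mulSingle_commute (f := fun _ : Fin n => Matrix.unitaryGroup (Fin 2) ℂ) h U V).map
    (tensorHom n)

theorem onQubit_apply_update (k : Fin n) (U : Matrix.unitaryGroup (Fin 2) ℂ)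
    (x : Fin n → Fin 2) (a : Fin 2) : (onQubit k U).1 x (Function.update x k a) = U.1 (x k) a := by
  change ∏ j, ((Pi.mulSingle k U : Fin n → Matrix.unitaryGroup (Fin 2) ℂ) j).1 (x j)
    (Function.update x k a j) = _
  rw [Finset.prod_eq_single k]
  · simp
  · intro j _ hj
    simp [hj]
  · simp

theorem onQubit_apply_eq_zero (k j : Fin n) (hj : j ≠ k) (U : Matrix.unitaryGroup (Fin 2) ℂ)
    (x y : Fin n → Fin 2) (h : x j ≠ y j) : (onQubit k U).1 x y = 0 := by
  change ∏ j, ((Pi.mulSingle k U : Fin n → Matrix.unitaryGroup (Fin 2) ℂ) j).1 (x j) (y j) = _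
  refine Finset.prod_eq_zero (Finset.mem_univ j) ?_
  simp [hj, h]

theorem onQubit_mul_apply (k : Fin n) (U : Matrix.unitaryGroup (Fin 2) ℂ)
    (M : Matrix (Fin n → Fin 2) (Fin n → Fin 2) ℂ) (x y : Fin n → Fin 2) :
    ((onQubit k U).1 * M) x y = ∑ a, U.1 (x k) a * M (Function.update x k a) y := by
  rw [Matrix.mul_apply, ← Finset.sum_subset (Finset.subset_univ
    (Finset.univ.image (Function.update x k)))]
  · rw [Finset.sum_image fun a _ b _ h => by simpa using congrFun h k]
    simp only [onQubit_apply_update]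
  · intro z _ hz
    obtain ⟨j, hj, hjx⟩ : ∃ j, j ≠ k ∧ x j ≠ z j := by
      by_contra! hc
      refine hz (Finset.mem_image.mpr ⟨z k, Finset.mem_univ _, ?_⟩)
      ext j
      by_cases hj : j = k
      · subst hj; simp
      · simp [hj, hc j hj]
    rw [onQubit_apply_eq_zero k j hj U x z hjx, zero_mul]

theorem mul_onQubit_apply (k : Fin n) (U : Matrix.unitaryGroup (Fin 2) ℂ)
    (M : Matrix (Fin n → Fin 2) (Fin n → Fin 2) ℂ) (x y : Fin n → Fin 2) :
    (M * (onQubit k U).1) x y = ∑ a, M x (Function.update y k a) * U.1 a (y k) := by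
  have h := congrArg star (onQubit_mul_apply k U⁻¹ (star M) y x)
  rw [map_inv] at h
  simpa [Matrix.mul_apply, Matrix.star_apply, mul_comm] using h

theorem coe_onQubit_pauliZ (k : Fin n) : (onQubit k pauliZ).1 =
    Matrix.diagonal fun x => if x k = 0 then 1 else -1 := by
  ext x y
  rw [← mul_one (onQubit k pauliZ).1, onQubit_mul_apply]
  obtain h | h : x k = 0 ∨ x k = 1 := by omega
  all_goals
    have h1 : Function.update x k (x k) = x := Function.update_eq_self _ _
    rw [h] at h1
    simp [pauliZ, h, h1, Matrix.one_apply, Matrix.diagonal_apply]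

/-- A function on the cube that is invariant under changing any one coordinate is constant. -/
theorem eq_of_update_invariant {α : Type*} {f : (Fin n → Fin 2) → α}
    (hf : ∀ x k a, f (Function.update x k a) = f x) (x y : Fin n → Fin 2) : f x = f y := by
  have h : ∀ s : Finset (Fin n), f (s.piecewise x y) = f y := by
    intro s
    induction s using Finset.induction with
    | empty => simp
    | insert j s _ ih => rw [Finset.piecewise_insert, hf, ih]
  simpa using h Finset.univ

/-- The matrices `X` and `Z` on the individual qubits act irreducibly: a matrix commuting with all
`Z`s is diagonal, and commuting with all `X`s then makes its diagonal constant. -/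
theorem mem_globalPhase_of_commute {U : Matrix.unitaryGroup (Fin n → Fin 2) ℂ}
    (hX : ∀ k, Commute U (onQubit k pauliX)) (hZ : ∀ k, Commute U (onQubit k pauliZ)) :
    U ∈ globalPhase n := by
  have hd : ∀ x y, x ≠ y → U.1 x y = 0 := by
    intro x y hxy
    obtain ⟨k, hk⟩ := Function.ne_iff.mp hxy
    have h := congrFun (congrFun (congrArg Subtype.val (hZ k).eq) x) y
    simp only [Submonoid.coe_mul, coe_onQubit_pauliZ, Matrix.mul_diagonal,
      Matrix.diagonal_mul] at h
    obtain ⟨h1, h2⟩ | ⟨h1, h2⟩ : (x k = 0 ∧ y k = 1) ∨ (x k = 1 ∧ y k = 0) := by omega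
    · simp only [h1, h2, if_true, one_ne_zero, if_false] at h
      linear_combination (-1 / 2 : ℂ) * h
    · simp only [h1, h2, if_true, one_ne_zero, if_false] at h
      linear_combination (1 / 2 : ℂ) * h
  have hc : ∀ x k a, U.1 (Function.update x k a) (Function.update x k a) = U.1 x x := by
    intro x k a
    have h := congrFun (congrFun (congrArg Subtype.val (hX k).eq) x) (Function.update x k a)
    simp only [Submonoid.coe_mul, onQubit_mul_apply, mul_onQubit_apply] at h
    by_cases ha : a = x k
    · rw [ha, Function.update_eq_self]
    · obtain ⟨h1, h2⟩ | ⟨h1, h2⟩ : (x k = 0 ∧ a = 1) ∨ (x k = 1 ∧ a = 0) := by omega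
      all_goals
        have h3 : Function.update x k (x k) = x := Function.update_eq_self _ _
        rw [h1] at h3
        simp [pauliX, h1, h2, h3] at h
        rw [h2, h]
  refine ⟨U.1 0 0, ?_⟩
  ext x y
  by_cases hxy : x = y
  · subst hxy
    simpa using eq_of_update_invariant (f := fun x => U.1 x x) hc x 0
  · simp [hd x y hxy, hxy]
end

/-! ### Anticommuting elements -/

section Anticommute

/-- The elements `a` and `b` satisfy `a * b = -(b * a)`. -/
def Anticommute {G : Type*} [Mul G] [Neg G] (a b : G) : Prop := a * b = -(b * a)

variable {G : Type*} [Group G] [HasDistribNeg G] {a b c : G}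

theorem Anticommute.symm (h : Anticommute a b) : Anticommute b a := by
  rw [Anticommute, show a * b = _ from h, neg_neg]

theorem Anticommute.mul_right (h : Anticommute a b) (h' : Commute a c) :
    Anticommute a (b * c) := by
  rw [Anticommute, ← mul_assoc, show a * b = _ from h, neg_mul, mul_assoc, h'.eq, mul_assoc]

theorem Commute.mul_right_anticommute (h : Commute a b) (h' : Anticommute a c) :
    Anticommute a (b * c) := by
  rw [Anticommute, ← mul_assoc, h.eq, mul_assoc, show a * c = _ from h', mul_neg, mul_assoc]

theorem Anticommute.mul_right_commute (h : Anticommute a b) (h' : Anticommute a c) :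
    Commute a (b * c) := by
  rw [Commute, SemiconjBy, ← mul_assoc, show a * b = _ from h, neg_mul, mul_assoc,
    show a * c = _ from h', mul_neg, neg_neg, mul_assoc]

theorem Anticommute.conj (h : Anticommute a b) (c : G) :
    Anticommute (c * a * c⁻¹) (c * b * c⁻¹) := by
  have h' : a * b = -(b * a) := h
  rw [Anticommute, show c * a * c⁻¹ * (c * b * c⁻¹) = c * (a * b) * c⁻¹ by group,
    show c * b * c⁻¹ * (c * a * c⁻¹) = c * (b * a) * c⁻¹ by group, h', mul_neg, neg_mul]

theorem Anticommute.left_mul (h : Anticommute a b) : Anticommute a (a * b) :=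
  (Commute.refl a).mul_right_anticommute h

theorem Anticommute.right_mul (h : Anticommute a b) : Anticommute b (a * b) :=
  h.symm.mul_right (Commute.refl b)

end Anticommute

/-! ### The Pauli group -/

section
variable {n : ℕ}

theorem coe_onQubit_of_scalar (k : Fin n) {V : Matrix.unitaryGroup (Fin 2) ℂ} {c : ℂ}
    (hV : V.1 = c • 1) : (onQubit k V).1 = c • 1 := by
  ext x y
  rw [← mul_one (onQubit k V).1, onQubit_mul_apply, hV,
    Finset.sum_eq_single (x k) (fun a _ ha => by simp [ha.symm]) (by simp),
    Function.update_eq_self]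
  simp

theorem onQubit_neg (k : Fin n) (V : Matrix.unitaryGroup (Fin 2) ℂ) :
    onQubit k (-V) = -onQubit k V := by
  have h : onQubit k (-1) = -1 := Subtype.ext <| by
    rw [coe_onQubit_of_scalar k (c := -1) (by simp [Unitary.coe_neg])]
    simp [Unitary.coe_neg]
  rw [← neg_one_mul, map_mul, h, neg_one_mul]

/-- The Pauli matrix `X` (for `b = false`) or `Z` (for `b = true`) on qubit `k`. -/
noncomputable def pauliGenerator (k : Fin n) (b : Bool) :
    Matrix.unitaryGroup (Fin n → Fin 2) ℂ :=
  onQubit k (bif b then pauliZ else pauliX)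

theorem pauliGenerator_commute {j k : Fin n} (h : j ≠ k) (b c : Bool) :
    Commute (pauliGenerator j b) (pauliGenerator k c) :=
  onQubit_commute h _ _

theorem pauliGenerator_anticommute (k : Fin n) (b : Bool) :
    Anticommute (pauliGenerator k b) (pauliGenerator k !b) := by
  have h : pauliX * pauliZ = -(pauliZ * pauliX) := by
    ext i j
    fin_cases i <;> fin_cases j <;> simp [pauliX, pauliZ, Unitary.coe_neg]
  have h' : Anticommute (onQubit k pauliX) (onQubit k pauliZ) := by
    rw [Anticommute, ← map_mul, h, onQubit_neg, map_mul]
  cases b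
  · exact h'
  · exact h'.symm

theorem pauliGenerator_mul_self (k : Fin n) (b : Bool) :
    pauliGenerator k b * pauliGenerator k b = 1 := by
  rw [pauliGenerator, ← map_mul, ← map_one (onQubit k)]
  congr 1
  ext i j
  cases b <;> fin_cases i <;> fin_cases j <;> simp [pauliX, pauliZ]

theorem onQubit_mem_pauliSubgroup (k : Fin n) {V : Matrix.unitaryGroup (Fin 2) ℂ}
    (hV : V = 1 ∨ V = pauliX ∨ V = pauliY ∨ V = pauliZ) : onQubit k V ∈ pauliSubgroup n := by
  refine Subgroup.subset_closure ⟨Pi.mulSingle k V, fun j => ?_, rfl⟩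
  by_cases hj : j = k
  · subst hj; simpa using hV
  · simp [hj]

theorem pauliGenerator_mem (k : Fin n) (b : Bool) : pauliGenerator k b ∈ pauliSubgroup n :=
  onQubit_mem_pauliSubgroup k (by cases b <;> simp)

/-- The scalar matrix `i`. -/
noncomputable def phaseI (n : ℕ) : Matrix.unitaryGroup (Fin n → Fin 2) ℂ :=
  ⟨Complex.I • 1, by
    rw [Matrix.mem_unitaryGroup_iff]
    simp [smul_smul]⟩

theorem phaseI_mem_globalPhase : phaseI n ∈ globalPhase n := ⟨Complex.I, rfl⟩

theorem phaseI_mul_self : phaseI n * phaseI n = -1 := Subtype.ext <| by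
  simp [phaseI, smul_smul, Unitary.coe_neg]

theorem coe_phaseI_inv_mul (P : Matrix.unitaryGroup (Fin n → Fin 2) ℂ) :
    ((phaseI n)⁻¹ * P).1 = (-Complex.I) • P.1 := by
  simp [phaseI]

theorem phaseI_mem_pauliSubgroup (k : Fin n) : phaseI n ∈ pauliSubgroup n := by
  have h : phaseI n = onQubit k pauliX * onQubit k pauliY * onQubit k pauliZ := by
    rw [← map_mul, ← map_mul]
    refine Subtype.ext (coe_onQubit_of_scalar k ?_).symm
    ext i j
    fin_cases i <;> fin_cases j <;> simp [pauliX, pauliY, pauliZ]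
  rw [h]
  exact mul_mem (mul_mem (onQubit_mem_pauliSubgroup k (by simp))
    (onQubit_mem_pauliSubgroup k (by simp))) (onQubit_mem_pauliSubgroup k (by simp))

theorem neg_mem_pauliSubgroup (k : Fin n) {P : Matrix.unitaryGroup (Fin n → Fin 2) ℂ}
    (hP : P ∈ pauliSubgroup n) : -P ∈ pauliSubgroup n := by
  rw [← neg_one_mul, ← phaseI_mul_self]
  exact mul_mem (mul_mem (phaseI_mem_pauliSubgroup k) (phaseI_mem_pauliSubgroup k)) hP

theorem commute_of_mem_globalPhase {U V : Matrix.unitaryGroup (Fin n → Fin 2) ℂ}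
    (hU : U ∈ globalPhase n) : Commute U V := by
  obtain ⟨c, hc⟩ := hU
  exact Subtype.ext (by simp [hc])

theorem Anticommute.not_commute {U V : Matrix.unitaryGroup (Fin n → Fin 2) ℂ}
    (h : Anticommute U V) : ¬ Commute U V := by
  intro hc
  have h1 : V * U = -(V * U) := hc.eq.symm.trans h
  have h2 : (1 : Matrix.unitaryGroup (Fin n → Fin 2) ℂ) = -1 := by
    calc (1 : Matrix.unitaryGroup (Fin n → Fin 2) ℂ) = (V * U) * (V * U)⁻¹ := by group
      _ = -1 := by nth_rw 1 [h1]; rw [neg_mul, mul_inv_cancel]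
  have h3 := congrFun (congrFun (congrArg Subtype.val h2) 0) 0
  norm_num [Unitary.coe_neg] at h3

theorem Anticommute.notMem_globalPhase {U V : Matrix.unitaryGroup (Fin n → Fin 2) ℂ}
    (h : Anticommute U V) : U ∉ globalPhase n :=
  fun hU => h.not_commute (commute_of_mem_globalPhase hU)

theorem onePauli_commute_or {σ τ : Matrix.unitaryGroup (Fin 2) ℂ}
    (hσ : σ = 1 ∨ σ = pauliX ∨ σ = pauliY ∨ σ = pauliZ)
    (hτ : τ = 1 ∨ τ = pauliX ∨ τ = pauliY ∨ τ = pauliZ) :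
    ∃ c : ℂ, (c = 1 ∨ c = -1) ∧ σ.1 * τ.1 = c • (τ.1 * σ.1) := by
  rcases hσ with rfl | rfl | rfl | rfl <;> rcases hτ with rfl | rfl | rfl | rfl <;>
    first
    | (refine ⟨1, Or.inl rfl, ?_⟩; simp; done)
    | exact ⟨-1, Or.inr rfl, by
        ext i j; fin_cases i <;> fin_cases j <;> simp [pauliX, pauliY, pauliZ]⟩

theorem tensorMatrix_smul (c : Fin n → ℂ) (A : Fin n → Matrix (Fin 2) (Fin 2) ℂ) :
    tensorMatrix (fun k => c k • A k) = (∏ k, c k) • tensorMatrix A := by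
  ext x y
  simp [tensorMatrix, Finset.prod_mul_distrib]

theorem commute_or_anticommute_of_mem_pauliMatrices
    {P Q : Matrix.unitaryGroup (Fin n → Fin 2) ℂ} (hP : P ∈ pauliMatrices n)
    (hQ : Q ∈ pauliMatrices n) : Commute P Q ∨ Anticommute P Q := by
  obtain ⟨σ, hσ, rfl⟩ := hP
  obtain ⟨τ, hτ, rfl⟩ := hQ
  choose c hc h using fun k => onePauli_commute_or (hσ k) (hτ k)
  have key : (tensorUnitary σ * tensorUnitary τ).1 =
      (∏ k, c k) • (tensorUnitary τ * tensorUnitary σ).1 := by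
    change tensorMatrix _ * tensorMatrix _ = _ • (tensorMatrix _ * tensorMatrix _)
    rw [tensorMatrix_mul, tensorMatrix_mul, ← tensorMatrix_smul]
    exact congrArg tensorMatrix (funext h)
  have hs : ∏ k, c k = 1 ∨ ∏ k, c k = -1 := by
    refine Finset.prod_induction c (fun z => z = 1 ∨ z = -1) ?_ (Or.inl rfl) fun k _ => hc k
    rintro a b (rfl | rfl) (rfl | rfl) <;> simp
  rcases hs with hs | hs <;> rw [hs] at key
  · exact Or.inl (Subtype.ext (by simpa [Unitary.coe_neg] using key))
  · exact Or.inr (Subtype.ext (by simpa [Unitary.coe_neg] using key))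

theorem commute_or_anticommute {P Q : Matrix.unitaryGroup (Fin n → Fin 2) ℂ}
    (hP : P ∈ pauliSubgroup n) (hQ : Q ∈ pauliSubgroup n) : Commute P Q ∨ Anticommute P Q := by
  -- closure induction in the second variable, for any fixed element satisfying the dichotomy
  have right : ∀ P, (∀ Q ∈ pauliMatrices n, Commute P Q ∨ Anticommute P Q) →
      ∀ Q ∈ pauliSubgroup n, Commute P Q ∨ Anticommute P Q := by
    intro P h Q hQ
    induction hQ using Subgroup.closure_induction with
    | mem Q hQ => exact h Q hQ
    | one => exact Or.inl (Commute.one_right P)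
    | mul A B _ _ hA hB =>
      rcases hA with hA | hA <;> rcases hB with hB | hB
      · exact Or.inl (hA.mul_right hB)
      · exact Or.inr (hA.mul_right_anticommute hB)
      · exact Or.inr (hA.mul_right hB)
      · exact Or.inl (hA.mul_right_commute hB)
    | inv A _ hA =>
      rcases hA with hA | hA
      · exact Or.inl hA.inv_right
      · refine Or.inr ?_
        have h1 : P * A = -(A * P) := hA
        have h2 : A⁻¹ * (P * A) * A⁻¹ = A⁻¹ * -(A * P) * A⁻¹ := by rw [h1]
        rw [Anticommute, show A⁻¹ * P = A⁻¹ * (P * A) * A⁻¹ by group, h2, mul_neg, neg_mul,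
          neg_neg]
        group
  have symm : ∀ {A B : Matrix.unitaryGroup (Fin n → Fin 2) ℂ},
      Commute A B ∨ Anticommute A B → Commute B A ∨ Anticommute B A :=
    fun h => h.imp Commute.symm Anticommute.symm
  exact right P (fun Q hQ => symm (right Q
    (fun P hP => symm (commute_or_anticommute_of_mem_pauliMatrices hP hQ)) P hP)) Q hQ

/-- The commutation form is nondegenerate: only scalars commute with all `Xₖ` and `Zₖ`. -/
theorem exists_pauliGenerator_anticommute {P : Matrix.unitaryGroup (Fin n → Fin 2) ℂ}
    (hP : P ∈ pauliSubgroup n) (h : P ∉ globalPhase n) :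
    ∃ k b, Anticommute P (pauliGenerator k b) := by
  by_contra! hc
  have hc' : ∀ k b, Commute P (pauliGenerator k b) := fun k b =>
    (commute_or_anticommute hP (pauliGenerator_mem k b)).resolve_right (hc k b)
  exact h (mem_globalPhase_of_commute (fun k => hc' k false) fun k => hc' k true)

/-- A nonscalar element of square `1` in the Pauli group. These are the `± σ₁ ⊗ ⋯ ⊗ σₙ` with some
`σₖ ≠ I`; the definition refers only to what is preserved by conjugation with Clifford
unitaries. -/
structure IsPauliInvolution (P : Matrix.unitaryGroup (Fin n → Fin 2) ℂ) : Prop where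
  mem : P ∈ pauliSubgroup n
  mul_self : P * P = 1
  notMem_globalPhase : P ∉ globalPhase n

theorem pauliGenerator_isPauliInvolution (k : Fin n) (b : Bool) :
    IsPauliInvolution (pauliGenerator k b) :=
  ⟨pauliGenerator_mem k b, pauliGenerator_mul_self k b,
    (pauliGenerator_anticommute k b).notMem_globalPhase⟩

namespace IsPauliInvolution
variable {P Q R : Matrix.unitaryGroup (Fin n → Fin 2) ℂ}

theorem neg (hP : IsPauliInvolution P) : IsPauliInvolution (-P) := by
  obtain ⟨k, b, h⟩ := exists_pauliGenerator_anticommute hP.mem hP.notMem_globalPhase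
  refine ⟨neg_mem_pauliSubgroup k hP.mem, by simp [hP.mul_self], fun hn => ?_⟩
  obtain ⟨c, hc⟩ := hn
  exact hP.notMem_globalPhase ⟨-c, by rw [neg_smul, ← hc, Unitary.coe_neg, neg_neg]⟩

theorem conj (hP : IsPauliInvolution P) {U : Matrix.unitaryGroup (Fin n → Fin 2) ℂ}
    (hU : U ∈ cliffordUnitaries n) : IsPauliInvolution (U * P * U⁻¹) := by
  refine ⟨(Subgroup.mem_normalizer_iff.mp hU P).mp hP.mem, ?_, fun h => ?_⟩
  · rw [show U * P * U⁻¹ * (U * P * U⁻¹) = U * (P * P) * U⁻¹ by group, hP.mul_self]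
    group
  · have := (globalPhase_normal n).conj_mem _ h U⁻¹
    rw [show U⁻¹ * (U * P * U⁻¹) * U⁻¹⁻¹ = P by group] at this
    exact hP.notMem_globalPhase this

theorem mul_of_commute (hP : IsPauliInvolution P) (hQ : IsPauliInvolution Q) (h : Commute P Q)
    (hR : Anticommute (P * Q) R) : IsPauliInvolution (P * Q) :=
  ⟨mul_mem hP.mem hQ.mem, by
    rw [mul_assoc, ← mul_assoc Q, ← h.eq, mul_assoc, hQ.mul_self, mul_one, hP.mul_self],
    hR.notMem_globalPhase⟩

/-- The product of two anticommuting involutions has square `-1`, which the factor `-i`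
corrects. -/
theorem mul_of_anticommute (hP : IsPauliInvolution P) (hQ : IsPauliInvolution Q)
    (h : Anticommute P Q) : IsPauliInvolution ((phaseI n)⁻¹ * (P * Q)) := by
  obtain ⟨k, -⟩ := exists_pauliGenerator_anticommute hP.mem hP.notMem_globalPhase
  have hi : ∀ V, Commute (phaseI n)⁻¹ V := fun V =>
    (commute_of_mem_globalPhase phaseI_mem_globalPhase).inv_left
  refine ⟨mul_mem (inv_mem (phaseI_mem_pauliSubgroup k)) (mul_mem hP.mem hQ.mem), ?_,
    ((hi P).symm.mul_right_anticommute h.left_mul).symm.notMem_globalPhase⟩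
  have h1 : P * Q * (P * Q) = -1 := by
    have h' : Q * P = -(P * Q) := h.symm
    rw [mul_assoc, ← mul_assoc Q, h', neg_mul, mul_assoc, hQ.mul_self, mul_one, mul_neg,
      hP.mul_self]
  have h2 : (phaseI n)⁻¹ * (phaseI n)⁻¹ = -1 := by
    rw [← mul_inv_rev, phaseI_mul_self]
    exact inv_eq_of_mul_eq_one_left (by simp)
  rw [mul_assoc, ← mul_assoc (P * Q), ← (hi (P * Q)).eq, mul_assoc, h1, ← mul_assoc, h2]
  simp

/-- Any two nonscalar Pauli involutions have a common anticommuting partner. -/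
theorem exists_anticommute (hP : IsPauliInvolution P) (hQ : IsPauliInvolution Q) :
    ∃ R, IsPauliInvolution R ∧ Anticommute P R ∧ Anticommute R Q := by
  obtain ⟨j, b, hj⟩ := exists_pauliGenerator_anticommute hP.mem hP.notMem_globalPhase
  obtain ⟨k, c, hk⟩ := exists_pauliGenerator_anticommute hQ.mem hQ.notMem_globalPhase
  have hA := pauliGenerator_isPauliInvolution j b
  have hB := pauliGenerator_isPauliInvolution k c
  rcases commute_or_anticommute hQ.mem hA.mem with hj' | hj'
  · rcases commute_or_anticommute hP.mem hB.mem with hk' | hk'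
    · have h1 : Anticommute P (pauliGenerator j b * pauliGenerator k c) := hj.mul_right hk'
      have h2 : Anticommute Q (pauliGenerator j b * pauliGenerator k c) :=
        hj'.mul_right_anticommute hk
      rcases commute_or_anticommute hA.mem hB.mem with h | h
      · exact ⟨_, hA.mul_of_commute hB h h1.symm, h1, h2.symm⟩
      · have hi : ∀ V, Commute V (phaseI n)⁻¹ := fun V =>
          (commute_of_mem_globalPhase phaseI_mem_globalPhase).symm.inv_right
        exact ⟨_, hA.mul_of_anticommute hB h, (hi P).mul_right_anticommute h1,
          ((hi Q).mul_right_anticommute h2).symm⟩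
    · exact ⟨_, hB, hk', hk.symm⟩
  · exact ⟨_, hA, hj, hj'.symm⟩

end IsPauliInvolution
end

/-! ### Phase gates of Pauli involutions -/

section
variable {n : ℕ} {P Q R : Matrix.unitaryGroup (Fin n → Fin 2) ℂ}

/-- The phase gate `(1 + R) / 2 + i (1 - R) / 2` of a unitary involution `R`. Conjugation by
it induces the symplectic transvection along `R` on the Pauli group modulo phases. -/
noncomputable def phaseGate (R : Matrix.unitaryGroup (Fin n → Fin 2) ℂ) (hR : R * R = 1) :
    Matrix.unitaryGroup (Fin n → Fin 2) ℂ :=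
  ⟨phaseElement R.1, by
    rw [Matrix.mem_unitaryGroup_iff]
    refine phaseElement_mul_star (congrArg Subtype.val hR) ?_
    exact congrArg Subtype.val (inv_eq_of_mul_eq_one_left hR)⟩

theorem phaseGate_mul_self (hR : R * R = 1) : phaseGate R hR * phaseGate R hR = R :=
  Subtype.ext (phaseElement_mul_self (congrArg Subtype.val hR))

theorem phaseGate_mul_neg (hR : R * R = 1) (hR' : -R * -R = 1) :
    phaseGate R hR * phaseGate (-R) hR' = phaseI n :=
  Subtype.ext <| by
    simpa [phaseGate, phaseI, Unitary.coe_neg] using phaseElement_mul_neg (congrArg Subtype.val hR)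

theorem phaseGate_mul_eq (hP : P * P = 1) (hQ : Q * Q = 1) (h : Anticommute P Q)
    (hR : (phaseI n)⁻¹ * (P * Q) * ((phaseI n)⁻¹ * (P * Q)) = 1) :
    phaseGate _ hR * P = Q * phaseGate _ hR := by
  refine Subtype.ext ?_
  have h' : P.1 * Q.1 = -(Q.1 * P.1) := by simpa [Unitary.coe_neg] using congrArg Subtype.val h
  have := phaseElement_mul_eq (congrArg Subtype.val hP) (congrArg Subtype.val hQ) h'
  change phaseElement ((phaseI n)⁻¹ * (P * Q)).1 * P.1 = Q.1 * phaseElement _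
  rw [coe_phaseI_inv_mul]
  exact this

theorem commute_phaseGate {V : Matrix.unitaryGroup (Fin n → Fin 2) ℂ} (hR : R * R = 1)
    (h : Commute V R) : Commute V (phaseGate R hR) := by
  have h' : SemiconjBy V.1 R.1 R.1 := congrArg Subtype.val h
  exact Subtype.ext h'.phaseElement

theorem phaseGate_conj_mem (hR : IsPauliInvolution R) (hP : P ∈ pauliSubgroup n) :
    phaseGate R hR.mul_self * P * (phaseGate R hR.mul_self)⁻¹ ∈ pauliSubgroup n := by
  rcases commute_or_anticommute hR.mem hP with h | h
  · rwa [← (commute_phaseGate hR.mul_self h.symm).eq, mul_inv_cancel_right]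
  · obtain ⟨k, -⟩ := exists_pauliGenerator_anticommute hR.mem hR.notMem_globalPhase
    have key : phaseGate R hR.mul_self * P =
        (phaseI n)⁻¹ * (R * P) * phaseGate R hR.mul_self := by
      refine Subtype.ext ?_
      have h' : R.1 * P.1 = -(P.1 * R.1) := by
        simpa [Unitary.coe_neg] using congrArg Subtype.val h
      have := phaseElement_mul_of_anticommute (congrArg Subtype.val hR.mul_self) h'
      rw [Submonoid.coe_mul, Submonoid.coe_mul _ _ (phaseGate R hR.mul_self), coe_phaseI_inv_mul]
      exact this
    rw [key, mul_inv_cancel_right]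
    exact mul_mem (inv_mem (phaseI_mem_pauliSubgroup k)) (mul_mem hR.mem hP)

theorem phaseGate_mem (hR : IsPauliInvolution R) :
    phaseGate R hR.mul_self ∈ cliffordUnitaries n := by
  refine Subgroup.mem_normalizer_iff.mpr fun P => ⟨phaseGate_conj_mem hR, fun h => ?_⟩
  have h1 := phaseGate_conj_mem hR h
  have h2 := mul_mem (mul_mem (inv_mem hR.mem) h1) hR.mem
  have h3 := phaseGate_mul_self hR.mul_self
  set S := phaseGate R hR.mul_self
  -- the gate squares to `R`, so conjugating by it twice and then by `R⁻¹` changes nothing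
  rwa [show R⁻¹ * (S * (S * P * S⁻¹) * S⁻¹) * R = P by rw [← h3]; group] at h2

theorem globalPhase_le_cliffordUnitaries (n : ℕ) : globalPhase n ≤ cliffordUnitaries n :=
  fun U hU => Subgroup.mem_normalizer_iff.mpr fun P => by
    rw [(commute_of_mem_globalPhase hU : Commute U P).eq, mul_inv_cancel_right]

/-! ### Generation by phase gates -/

/-- One phase gate carries an involution to an anticommuting one. The gate commutes with whatever
commutes with the product of the two. -/
theorem exists_carry_of_anticommute {K : Subgroup (Matrix.unitaryGroup (Fin n → Fin 2) ℂ)}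
    (hK : ∀ R (hR : IsPauliInvolution R), phaseGate R hR.mul_self ∈ K)
    (hP : IsPauliInvolution P) (hQ : IsPauliInvolution Q) (h : Anticommute P Q) :
    ∃ V ∈ K, V ∈ cliffordUnitaries n ∧ V * P * V⁻¹ = Q ∧
      ∀ B, Commute B (P * Q) → Commute B V := by
  have hR := hP.mul_of_anticommute hQ h
  refine ⟨_, hK _ hR, phaseGate_mem hR, ?_, fun B hB => commute_phaseGate _ ?_⟩
  · rw [phaseGate_mul_eq hP.mul_self hQ.mul_self h, mul_inv_cancel_right]
  · exact (commute_of_mem_globalPhase phaseI_mem_globalPhase).symm.inv_right.mul_right hB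

/-- Two phase gates carry `P` to `Q` by way of a common anticommuting partner `R`. -/
theorem exists_carry {K : Subgroup (Matrix.unitaryGroup (Fin n → Fin 2) ℂ)}
    (hK : ∀ R (hR : IsPauliInvolution R), phaseGate R hR.mul_self ∈ K)
    (hP : IsPauliInvolution P) (hR : IsPauliInvolution R) (hQ : IsPauliInvolution Q)
    (h : Anticommute P R) (h' : Anticommute R Q) :
    ∃ V ∈ K, V ∈ cliffordUnitaries n ∧ V * P * V⁻¹ = Q ∧
      ∀ B, Commute B (P * R) → Commute B (R * Q) → Commute B V := by
  obtain ⟨V, hV, hVc, hVP, hVB⟩ := exists_carry_of_anticommute hK hP hR h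
  obtain ⟨W, hW, hWc, hWR, hWB⟩ := exists_carry_of_anticommute hK hR hQ h'
  refine ⟨W * V, mul_mem hW hV, mul_mem hWc hVc, ?_,
    fun B h1 h2 => (hWB B h2).mul_right (hVB B h1)⟩
  rw [← hWR, ← hVP]
  group

/-- A Pauli involution commuting with `Xⱼ` and `Zⱼ` for all `j < k` is carried to `Xₖ` by phase
gates that also commute with these. -/
theorem exists_carry_to_X {K : Subgroup (Matrix.unitaryGroup (Fin n → Fin 2) ℂ)}
    (hK : ∀ R (hR : IsPauliInvolution R), phaseGate R hR.mul_self ∈ K)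
    (hP : IsPauliInvolution P) (k : Fin n)
    (hlow : ∀ j < k, ∀ b, Commute (pauliGenerator j b) P) :
    ∃ V ∈ K, V ∈ cliffordUnitaries n ∧ V * P * V⁻¹ = pauliGenerator k false ∧
      ∀ j < k, ∀ b, Commute (pauliGenerator j b) V := by
  have hX := pauliGenerator_isPauliInvolution k false
  have hZ := pauliGenerator_isPauliInvolution k true
  have hZX : Anticommute (pauliGenerator k true) (pauliGenerator k false) :=
    pauliGenerator_anticommute k true
  have low : ∀ j < k, ∀ b c, Commute (pauliGenerator j b) (pauliGenerator k c) :=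
    fun j hj => pauliGenerator_commute hj.ne
  rcases commute_or_anticommute hP.mem hX.mem with hPX | hPX
  swap
  · obtain ⟨V, h1, h2, h3, h4⟩ := exists_carry_of_anticommute hK hP hX hPX
    exact ⟨V, h1, h2, h3, fun j hj b => h4 _ ((hlow j hj b).mul_right (low j hj b _))⟩
  rcases commute_or_anticommute hP.mem hZ.mem with hPZ | hPZ
  swap
  · obtain ⟨V, h1, h2, h3, h4⟩ := exists_carry hK hP hZ hX hPZ hZX
    exact ⟨V, h1, h2, h3, fun j hj b => h4 _ ((hlow j hj b).mul_right (low j hj b _))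
      ((low j hj b _).mul_right (low j hj b _))⟩
  -- `P` commutes with everything on the qubits up to `k`, so it anticommutes with a generator `S`
  -- on a later qubit, and `Zₖ S` anticommutes with both `P` and `Xₖ`
  obtain ⟨l, c, hl⟩ := exists_pauliGenerator_anticommute hP.mem hP.notMem_globalPhase
  have hkl : k < l := by
    rcases lt_trichotomy l k with h | rfl | h
    · exact (hl.not_commute (hlow l h c).symm).elim
    · cases c
      · exact (hl.not_commute hPX).elim
      · exact (hl.not_commute hPZ).elim
    · exact h
  have hS := pauliGenerator_isPauliInvolution l c
  have hXR := hZX.symm.mul_right (pauliGenerator_commute hkl.ne false c)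
  have hR := hZ.mul_of_commute hS (pauliGenerator_commute hkl.ne true c) hXR.symm
  obtain ⟨V, h1, h2, h3, h4⟩ := exists_carry hK hP hR hX (hPZ.mul_right_anticommute hl) hXR.symm
  have lowR : ∀ j < k, ∀ b,
      Commute (pauliGenerator j b) (pauliGenerator k true * pauliGenerator l c) :=
    fun j hj b => (low j hj b _).mul_right (pauliGenerator_commute (hj.trans hkl).ne b c)
  exact ⟨V, h1, h2, h3, fun j hj b => h4 _ ((hlow j hj b).mul_right (lowR j hj b))
    ((lowR j hj b).mul_right (low j hj b _))⟩

/-- A Pauli involution that anticommutes with `Xₖ` and commutes with `Xⱼ` and `Zⱼ` for all `j < k`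
is carried to `Zₖ` by phase gates that commute with `Xₖ` and with these `Xⱼ` and `Zⱼ`. -/
theorem exists_carry_to_Z {K : Subgroup (Matrix.unitaryGroup (Fin n → Fin 2) ℂ)}
    (hK : ∀ R (hR : IsPauliInvolution R), phaseGate R hR.mul_self ∈ K)
    (hP : IsPauliInvolution P) (k : Fin n)
    (hlow : ∀ j < k, ∀ b, Commute (pauliGenerator j b) P)
    (hX : Anticommute (pauliGenerator k false) P) :
    ∃ V ∈ K, V ∈ cliffordUnitaries n ∧ V * P * V⁻¹ = pauliGenerator k true ∧
      Commute (pauliGenerator k false) V ∧ ∀ j < k, ∀ b, Commute (pauliGenerator j b) V := by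
  have hX' := pauliGenerator_isPauliInvolution k false
  have hZ := pauliGenerator_isPauliInvolution k true
  have hXZ : Anticommute (pauliGenerator k false) (pauliGenerator k true) :=
    pauliGenerator_anticommute k false
  have low : ∀ j < k, ∀ b c, Commute (pauliGenerator j b) (pauliGenerator k c) :=
    fun j hj => pauliGenerator_commute hj.ne
  rcases commute_or_anticommute hP.mem hZ.mem with hPZ | hPZ
  -- here `-i Xₖ Zₖ`, which is `Yₖ` up to sign, anticommutes with both `P` and `Zₖ`
  · have hi : ∀ V, Commute V (phaseI n)⁻¹ := fun V =>
      (commute_of_mem_globalPhase phaseI_mem_globalPhase).symm.inv_right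
    have hR := hX'.mul_of_anticommute hZ hXZ
    have hXR := (hi _).mul_right_anticommute hXZ.left_mul
    have hZR := (hi _).mul_right_anticommute hXZ.right_mul
    have hPR := (hi P).mul_right_anticommute (hX.symm.mul_right hPZ)
    obtain ⟨V, h1, h2, h3, h4⟩ := exists_carry hK hP hR hZ hPR hZR.symm
    have lowR := fun j hj b => (hi _).mul_right ((low j hj b false).mul_right (low j hj b true))
    exact ⟨V, h1, h2, h3, h4 _ (hX.mul_right_commute hXR) (hXR.mul_right_commute hXZ),
      fun j hj b => h4 _ ((hlow j hj b).mul_right (lowR j hj b))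
        ((lowR j hj b).mul_right (low j hj b _))⟩
  · obtain ⟨V, h1, h2, h3, h4⟩ := exists_carry_of_anticommute hK hP hZ hPZ
    exact ⟨V, h1, h2, h3, h4 _ (hX.mul_right_commute hXZ),
      fun j hj b => h4 _ ((hlow j hj b).mul_right (low j hj b _))⟩

/-- The Clifford unitaries are generated by the scalars and the phase gates of Pauli involutions:
multiplying `U` by phase gates makes it commute with `X₁, Z₁, X₂, Z₂, …` in turn, until it is
scalar. -/
theorem cliffordUnitaries_le {K : Subgroup (Matrix.unitaryGroup (Fin n → Fin 2) ℂ)}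
    (hphase : globalPhase n ≤ K)
    (hK : ∀ R (hR : IsPauliInvolution R), phaseGate R hR.mul_self ∈ K) :
    cliffordUnitaries n ≤ K := by
  -- downward induction on the number `m` of leading qubits whose `X` and `Z` commute with `U`
  suffices H : ∀ m ≤ n, ∀ U ∈ cliffordUnitaries n,
      (∀ j : Fin n, (j : ℕ) < m → ∀ b, Commute (pauliGenerator j b) U) → U ∈ K from
    fun U hU => H 0 n.zero_le U hU fun j hj => absurd hj (Nat.not_lt_zero _)
  intro m hm
  induction hm using Nat.decreasingInduction with
  | self =>
    exact fun U _ h => hphase (mem_globalPhase_of_commute (fun k => (h k k.2 false).symm)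
      fun k => (h k k.2 true).symm)
  | of_succ m hm ih =>
    intro U hU hlow
    let k : Fin n := ⟨m, hm⟩
    have hX := pauliGenerator_isPauliInvolution k false
    have hZ := pauliGenerator_isPauliInvolution k true
    have hcomm : ∀ {A B C : Matrix.unitaryGroup (Fin n → Fin 2) ℂ}, Commute A B → Commute A C →
        Commute A (B * C * B⁻¹) := fun h h' => (h.mul_right h').mul_right h.inv_right
    have low : ∀ j < k, ∀ b c, Commute (pauliGenerator j b) (pauliGenerator k c) :=
      fun j hj => pauliGenerator_commute hj.ne
    obtain ⟨V, hVK, hVC, hVX, hV⟩ := exists_carry_to_X hK (hX.conj hU) k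
      fun j hj b => hcomm (hlow j hj b) (low j hj b _)
    have hVU : V * U * pauliGenerator k false * (V * U)⁻¹ = pauliGenerator k false := by
      refine Eq.trans ?_ hVX
      group
    have hVUlow : ∀ j < k, ∀ b, Commute (pauliGenerator j b) (V * U) :=
      fun j hj b => (hV j hj b).mul_right (hlow j hj b)
    have hVUC := mul_mem hVC hU
    have hanti : Anticommute (pauliGenerator k false)
        (V * U * pauliGenerator k true * (V * U)⁻¹) := by
      have := (pauliGenerator_anticommute k false).conj (V * U)
      rwa [hVU] at this
    obtain ⟨W, hWK, hWC, hWZ, hWX, hW⟩ := exists_carry_to_Z hK (hZ.conj hVUC) k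
      (fun j hj b => hcomm (hVUlow j hj b) (low j hj b _)) hanti
    have hfin := ih (W * (V * U)) (mul_mem hWC hVUC) fun j hj b => by
      rcases Nat.lt_succ_iff_lt_or_eq.mp hj with hj | hj
      · exact (hW j hj b).mul_right (hVUlow j hj b)
      · obtain rfl : j = k := Fin.ext hj
        cases b
        · exact hWX.mul_right (mul_inv_eq_iff_eq_mul.mp hVU).symm
        · refine Commute.symm (mul_inv_eq_iff_eq_mul.mp ?_)
          refine Eq.trans ?_ hWZ
          group
    rwa [Subgroup.mul_mem_cancel_left _ hWK, Subgroup.mul_mem_cancel_left _ hVK] at hfin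
end

/-! ### Homomorphisms to commutative groups -/

section
variable {n : ℕ}

theorem phaseElement_diagonal {m : Type*} [Fintype m] [DecidableEq m] (d : m → ℂ) :
    phaseElement (Matrix.diagonal d) = Matrix.diagonal fun x => phaseElement (d x) := by
  ext x y
  by_cases h : x = y
  · subst h; simp [phaseElement]
  · simp [phaseElement, h]

/-- The phase elements of the seven nontrivial products of three commuting diagonal involutions
multiply to `1`. -/
theorem phaseElement_diagonal_seven {m : Type*} [Fintype m] [DecidableEq m] {a b c : m → ℂ}
    (ha : ∀ x, a x = 1 ∨ a x = -1) (hb : ∀ x, b x = 1 ∨ b x = -1) (hc : ∀ x, c x = 1 ∨ c x = -1) :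
    let A := Matrix.diagonal a
    let B := Matrix.diagonal b
    let C := Matrix.diagonal c
    phaseElement A * phaseElement B * phaseElement C * phaseElement (A * B) *
      phaseElement (A * C) * phaseElement (B * C) * phaseElement (A * B * C) = 1 := by
  have h1 : phaseElement (1 : ℂ) = 1 := by simp [phaseElement]; ring
  have h2 : phaseElement (-1 : ℂ) = Complex.I := by simp [phaseElement]; ring
  simp only [Matrix.diagonal_mul_diagonal, phaseElement_diagonal]
  rw [← Matrix.diagonal_one]
  congr 1
  funext x
  -- unless all three signs are `1`, exactly four of the seven products of signs are `-1`,
  -- and `i ^ 4 = 1`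
  rcases ha x with h | h <;> rcases hb x with h' | h' <;> rcases hc x with h'' | h'' <;>
    simp [h, h', h'', h1, h2]

/-- The phase gate of a Pauli involution, as an element of the group of Clifford unitaries. -/
noncomputable def cliffordPhaseGate {R : Matrix.unitaryGroup (Fin n → Fin 2) ℂ}
    (hR : IsPauliInvolution R) : cliffordUnitaries n :=
  ⟨phaseGate R hR.mul_self, phaseGate_mem hR⟩

variable {A : Type*} [CommGroup A] (f : cliffordUnitaries n →* A)
  {P Q : Matrix.unitaryGroup (Fin n → Fin 2) ℂ}

theorem map_cliffordPhaseGate_eq_of_anticommute (hP : IsPauliInvolution P)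
    (hQ : IsPauliInvolution Q) (h : Anticommute P Q) :
    f (cliffordPhaseGate hP) = f (cliffordPhaseGate hQ) := by
  have hR := hP.mul_of_anticommute hQ h
  have h1 := phaseGate_mul_eq hP.mul_self hQ.mul_self h hR.mul_self
  have h2 : SemiconjBy (phaseGate _ hR.mul_self).1 P.1 Q.1 := congrArg Subtype.val h1
  have h3 : cliffordPhaseGate hR * cliffordPhaseGate hP =
      cliffordPhaseGate hQ * cliffordPhaseGate hR :=
    Subtype.ext (Subtype.ext h2.phaseElement)
  have h4 := congrArg f h3
  rw [map_mul, map_mul, mul_comm] at h4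
  exact mul_right_cancel h4

/-- All phase gates are conjugate in the group of Clifford unitaries. -/
theorem map_cliffordPhaseGate_eq (hP : IsPauliInvolution P) (hQ : IsPauliInvolution Q) :
    f (cliffordPhaseGate hP) = f (cliffordPhaseGate hQ) := by
  obtain ⟨R, hR, h, h'⟩ := hP.exists_anticommute hQ
  exact (map_cliffordPhaseGate_eq_of_anticommute f hP hR h).trans
    (map_cliffordPhaseGate_eq_of_anticommute f hR hQ h')

/-- The phase gates of `P` and `-P` have the same image and are inverse to each other up to a
scalar. -/
theorem map_cliffordPhaseGate_mul_self (hf : ∀ U, U.1 ∈ globalPhase n → f U = 1)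
    (hP : IsPauliInvolution P) : f (cliffordPhaseGate hP) * f (cliffordPhaseGate hP) = 1 := by
  nth_rw 2 [map_cliffordPhaseGate_eq f hP hP.neg]
  rw [← map_mul]
  refine hf _ ?_
  change phaseGate P hP.mul_self * phaseGate (-P) hP.neg.mul_self ∈ _
  rw [phaseGate_mul_neg]
  exact phaseI_mem_globalPhase

/-- The seven nontrivial products of `Z₁`, `Z₂`, `Z₃` have phase gates with product `1`. This is
where three qubits are needed. -/
theorem map_cliffordPhaseGate_pow_seven (hn : 3 ≤ n) (hP : IsPauliInvolution P) :
    f (cliffordPhaseGate hP) ^ 7 = 1 := by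
  let i : Fin n := ⟨0, by omega⟩
  let j : Fin n := ⟨1, by omega⟩
  let k : Fin n := ⟨2, by omega⟩
  have hij : i ≠ j := by simp [i, j]
  have hik : i ≠ k := by simp [i, k]
  have hjk : j ≠ k := by simp [j, k]
  have ha := pauliGenerator_isPauliInvolution i true
  have hb := pauliGenerator_isPauliInvolution j true
  have hc := pauliGenerator_isPauliInvolution k true
  have cab := pauliGenerator_commute hij true true
  have cac := pauliGenerator_commute hik true true
  have cbc := pauliGenerator_commute hjk true true
  have xa := pauliGenerator_anticommute i false
  have xb := pauliGenerator_anticommute j false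
  have xab := xa.mul_right (pauliGenerator_commute hij false true)
  have hab := ha.mul_of_commute hb cab xab.symm
  have hac := ha.mul_of_commute hc cac (xa.mul_right (pauliGenerator_commute hik false true)).symm
  have hbc := hb.mul_of_commute hc cbc (xb.mul_right (pauliGenerator_commute hjk false true)).symm
  have habc := hab.mul_of_commute hc (cac.mul_left cbc)
    (xab.mul_right (pauliGenerator_commute hik false true)).symm
  have sign : ∀ (l : Fin n) (x : Fin n → Fin 2),
      (if x l = 0 then (1 : ℂ) else -1) = 1 ∨ (if x l = 0 then (1 : ℂ) else -1) = -1 := by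
    intro l x
    split_ifs <;> simp
  have key : cliffordPhaseGate ha * cliffordPhaseGate hb * cliffordPhaseGate hc *
      cliffordPhaseGate hab * cliffordPhaseGate hac * cliffordPhaseGate hbc *
      cliffordPhaseGate habc = 1 := by
    refine Subtype.ext (Subtype.ext ?_)
    have := phaseElement_diagonal_seven (sign i) (sign j) (sign k)
    simp only [← coe_onQubit_pauliZ] at this
    exact this
  have h := congrArg f key
  simp only [map_mul, map_one, map_cliffordPhaseGate_eq f _ hP] at h
  rw [← h]
  simp only [pow_succ, pow_zero, one_mul]

theorem cliffordUnitaries_hom_eq_one (hn : 3 ≤ n) (hf : ∀ U, U.1 ∈ globalPhase n → f U = 1) :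
    f = 1 := by
  have hgate : ∀ R (hR : IsPauliInvolution R), f (cliffordPhaseGate hR) = 1 := by
    intro R hR
    have h2 := map_cliffordPhaseGate_mul_self f hf hR
    have h7 := map_cliffordPhaseGate_pow_seven f hn hR
    rw [← pow_two] at h2
    rwa [show 7 = 2 * 3 + 1 from rfl, pow_succ, pow_mul, h2, one_pow, one_mul] at h7
  have hle : cliffordUnitaries n ≤ f.ker.map (cliffordUnitaries n).subtype :=
    cliffordUnitaries_le
      (fun U hU => ⟨⟨U, globalPhase_le_cliffordUnitaries n hU⟩, hf _ hU, rfl⟩)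
      fun R hR => ⟨cliffordPhaseGate hR, hgate R hR, rfl⟩
  ext U
  obtain ⟨V, hV, hVU⟩ := hle U.2
  obtain rfl : V = U := Subtype.ext hVU
  exact hV

theorem cliffordGroup_hom_eq_one (hn : 3 ≤ n) (g : CliffordGroup n →* A) : g = 1 := by
  refine QuotientGroup.monoidHom_ext _ ?_
  refine cliffordUnitaries_hom_eq_one _ hn fun U hU => ?_
  have : (QuotientGroup.mk' ((globalPhase n).subgroupOf (cliffordUnitaries n))) U = 1 :=
    (QuotientGroup.eq_one_iff U).mpr hU
  rw [MonoidHom.comp_apply, this, map_one]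
end

theorem theorem5p2 (n : ℕ) (hn : 3 ≤ n) :
    (∀ χ : CliffordGroup n →* ℂˣ, χ = 1) ∧ commutator (CliffordGroup n) = ⊤ := by
  refine ⟨cliffordGroup_hom_eq_one hn, ?_⟩
  rw [eq_top_iff, ← Abelianization.ker_of, cliffordGroup_hom_eq_one hn Abelianization.of]
  simp
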